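/- Let $X$ be a complex Banach space, $\Omega\subseteq\mathbb{C}$ open, and let $R:\Omega\to L(X)$ be a pseudo-resolvent, i.e. $$R(\lambda)-R(\mu)=(\lambda-\mu)R(\lambda)R(\mu)\qquad\text{for all }\lambda,\mu\in\Omega$$ (the sign convention of $R(\lambda)=(A-\lambda)^{-1}$). Let $k\ge 1$ and assume condition $(D_k)$: there are $\omega\in\mathbb{R}$ and $M>0$ with $[\omega,\infty)\subseteq\Omega$ and $$\|R(\lambda)x\|\le \frac{M}{\lambda-\omega}\|x\|\qquad\text{for all }\lambda\in(\omega,\infty),\ x\in\operatorname{ran}R(\omega)^{k-1}.$$ Let $\mu\in\Omega$, put $V:=\overline{\operatorname{ran}R(\mu)^k}$, and let $A_R$ be the operator in $V$ with graph $\{(R(\mu)x,\;x+\mu R(\mu)x) : x\in V\}$. Assume that $A_R$ generates a strongly continuous semigroup $(T(t))_{t\ge0}$ on $V$. Let $t_f>0$, $w_0\in V$, and put $w_\mu(t)=e^{-\mu t}T(t)w_0$ for $t\in[0,t_f]$. Consider the homogeneous pseudo-resolvent equation $$\tfrac{d}{dt}R(\mu)w(t)=w(t),\quad t\in[0,t_f],\qquad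 R(\mu)w(0)=R(\mu)w_0. \qquad(*)$$ A function $w:[0,t_f]\to X$ is called * a *classical solution* of $(*)$ if $R(\mu)w\in C([0,t_f];X)\cap C^1((0,t_f);X)$, $R(\mu)w(0)=R(\mu)w_0$, and $\frac{d}{dt}R(\mu)w(t)=w(t)$ for all $t\in(0,t_f)$; * a *mild solution* if $w\in L^1([0,t_f];X)$ (Bochner), $R(\mu)w\in C([0,t_f];X)$, and $R(\mu)w(t)-R(\mu)w_0=\int_0^t w(\tau)\,d\tau$ for almost all $t\in[0,t_f]$; * a *weak solution* if $R(\mu)w\in C([0,t_f];X)$, $R(\mu)w(0)=R(\mu)w_0$, and for every $x'\in X'$ the function $t\mapsto\langle R(\mu)w(t),x'\rangle$ lies in $W^{1,1}([0,t_f])$ with weak derivative $t\mapsto\langle w(t),x'\rangle$. Then the following holds. 1. $w_\mu$ is a mild solution of $(*)$, and it is the unique one: every mild solution $w$ satisfies $w=w_\mu$ almost everywhere on $[0,t_f]$ and $R(\mu)w=R(\mu)w_\mu$ on all of $[0,t_f]$. 2. $w_\mu$ is a weak solution of $(*)$, and it is the unique one up to weak equivalence: every weak solution $w$ satisfies $R(\mu)w=R(\mu)w_\mu$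 on all of $[0,t_f]$ and, for every $x'\in X'$, $\langle w(t),x'\rangle=\langle w_\mu(t),x'\rangle$ for almost all $t\in[0,t_f]$; if moreover $w(t)$ lies in some fixed separable subset of $X$ for almost all $t$ (e.g. if $w$ is strongly measurable or $X$ is separable), then $w=w_\mu$ almost everywhere on $[0,t_f]$. 3. If $w_0\in R(\mu)V$, then $w_\mu$ is a classical solution of $(*)$, and it is the unique one: every classical solution $w$ satisfies $w=w_\mu$ on $(0,t_f)$ and $R(\mu)w=R(\mu)w_\mu$ on all of $[0,t_f]$. -/

import Mathlib

open Set Filter Topology MeasureTheory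
open scoped ContDiff

namespace ADAE

/-! ### Solution concepts for `d/dt E x(t) = A x(t) + f(t)`, `(E x)(0) = E x₀` on `[0, t_f]`.
Functions on `[0, t_f]` are represented by functions on `ℝ` of which only the values on
`[0, t_f]` matter. -/

section Solutions

variable {X Z : Type*} [NormedAddCommGroup X] [NormedSpace ℂ X]
  [NormedAddCommGroup Z] [NormedSpace ℂ Z]

/-- Classical solution. -/
structure IsClassicalSolution (E : X →ₗ[ℂ] Z) (A : X →ₗ.[ℂ] Z) (f : ℝ → Z) (x₀ : X) (tf : ℝ)
    (x : ℝ → X) : Prop where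
  continuousOn : ContinuousOn (fun t => E (x t)) (Icc 0 tf)
  contDiffOn : ContDiffOn ℝ 1 (fun t => E (x t)) (Ioo 0 tf)
  initial : E (x 0) = E x₀
  equation : ∀ t ∈ Ioo 0 tf, ∃ h : x t ∈ A.domain,
    HasDerivAt (fun s => E (x s)) (A ⟨x t, h⟩ + f t) t

/-- Mild solution (all integrals are Bochner integrals). -/
structure IsMildSolution (E : X →ₗ[ℂ] Z) (A : X →ₗ.[ℂ] Z) (f : ℝ → Z) (x₀ : X) (tf : ℝ)
    (x : ℝ → X) : Prop where
  integrable_rhs : IntegrableOn f (Icc 0 tf)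
  continuousOn : ContinuousOn (fun t => E (x t)) (Icc 0 tf)
  integrable : IntegrableOn x (Icc 0 tf)
  equation : ∀ᵐ t ∂(volume.restrict (Icc 0 tf)), ∃ h : (∫ τ in (0 : ℝ)..t, x τ) ∈ A.domain,
    E (x t) - E x₀ = A ⟨∫ τ in (0 : ℝ)..t, x τ, h⟩ + ∫ τ in (0 : ℝ)..t, f τ

/-- `u` belongs to `W^{1,1}([a, b])` and `g` is its weak derivative. -/
structure HasWeakDerivOn (u g : ℝ → ℂ) (a b : ℝ) : Prop where
  integrable : IntegrableOn u (Icc a b)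
  integrable_deriv : IntegrableOn g (Icc a b)
  integral_eq : ∀ φ : ℝ → ℝ, ContDiff ℝ ∞ φ → HasCompactSupport φ → tsupport φ ⊆ Ioo a b →
    ∫ t in Icc a b, deriv φ t • u t = -∫ t in Icc a b, φ t • g t

/-- `z'` belongs to the domain of the dual operator `A'` and `A' z' = x'`. -/
def DualApplies (A : X →ₗ.[ℂ] Z) (z' : StrongDual ℂ Z) (x' : StrongDual ℂ X) : Prop :=
  ∀ x : A.domain, x' (x : X) = z' (A x)

/-- Weak solution. -/
structure IsWeakSolution (E : X →ₗ[ℂ] Z) (A : X →ₗ.[ℂ] Z) (f : ℝ → Z) (x₀ : X) (tf : ℝ)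
    (x : ℝ → X) : Prop where
  dense_domain : Dense (A.domain : Set X)
  continuousOn : ContinuousOn (fun t => E (x t)) (Icc 0 tf)
  initial : E (x 0) = E x₀
  integrable_rhs : ∀ z' : StrongDual ℂ Z, IntegrableOn (fun t => z' (f t)) (Icc 0 tf)
  sobolev : ∀ z' : StrongDual ℂ Z, ∃ g : ℝ → ℂ, HasWeakDerivOn (fun t => z' (E (x t))) g 0 tf
  equation : ∀ (z' : StrongDual ℂ Z) (x' : StrongDual ℂ X), DualApplies A z' x' →
    HasWeakDerivOn (fun t => z' (E (x t))) (fun t => x' (x t) + z' (f t)) 0 tf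

end Solutions

section Semigroup

variable {V : Type*} [NormedAddCommGroup V] [NormedSpace ℂ V]

/-- `(T t)_{t ≥ 0}` is a strongly continuous semigroup of bounded operators
(the values of `T` at negative times are irrelevant). -/
structure IsC0Semigroup (T : ℝ → V →L[ℂ] V) : Prop where
  zero : T 0 = ContinuousLinearMap.id ℂ V
  add : ∀ s t : ℝ, 0 ≤ s → 0 ≤ t → T (s + t) = (T s).comp (T t)
  continuousOn : ∀ x : V, ContinuousOn (fun t => T t x) (Ici 0)

/-- The operator with graph `G` is the infinitesimal generator of the strongly continuous
semigroup `T`. -/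
def Generates (G : Submodule ℂ (V × V)) (T : ℝ → V →L[ℂ] V) : Prop :=
  IsC0Semigroup T ∧
    ∀ x y : V, (x, y) ∈ G ↔ Tendsto (fun h : ℝ => h⁻¹ • (T h x - x)) (𝓝[>] 0) (𝓝 y)

end Semigroup

section PseudoResolvent

variable {X : Type*} [NormedAddCommGroup X] [NormedSpace ℂ X]

/-- `R` is a pseudo-resolvent on `Ω` (only the values of `R` on `Ω` matter), with the sign
convention of `R(l) = (A - l)⁻¹`. -/
structure IsPseudoResolvent (Ω : Set ℂ) (R : ℂ → X →L[ℂ] X) : Prop where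
  isOpen : IsOpen Ω
  resolvent_identity : ∀ l ∈ Ω, ∀ m ∈ Ω, R l - R m = (l - m) • (R l * R m)

/-- The condition `(D_k)`, for `k ≥ 1`. -/
def CondD (k : ℕ) (Ω : Set ℂ) (R : ℂ → X →L[ℂ] X) : Prop :=
  ∃ w M : ℝ, 0 < M ∧ (∀ l : ℝ, w ≤ l → (l : ℂ) ∈ Ω) ∧
    ∀ l : ℝ, w < l → ∀ x ∈ ((R (w : ℂ)) ^ (k - 1)).range,
      ‖R (l : ℂ) x‖ ≤ M / (l - w) * ‖x‖

/-- The closure of `ran S ^ k`. -/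
def closedRange (k : ℕ) (S : X →L[ℂ] X) : Submodule ℂ X :=
  (S ^ k).range.topologicalClosure

/-- The graph of `A_R`, i.e. `{(R(μ) v, v + μ R(μ) v) | v ∈ V}`, as a linear relation in
`V = closure of ran R(μ) ^ k`; here `S = R(μ)`. -/
def graphAR (k : ℕ) (μ : ℂ) (S : X →L[ℂ] X) :
    Submodule ℂ (closedRange k S × closedRange k S) where
  carrier := {p | ∃ v : closedRange k S, (p.1 : X) = S v ∧ (p.2 : X) = v + μ • S v}
  zero_mem' := ⟨0, by simp⟩
  add_mem' := by
    rintro p q ⟨v, hv, hv'⟩ ⟨w, hw, hw'⟩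
    refine ⟨v + w, by simp [hv, hw], ?_⟩
    simp only [Prod.snd_add, Submodule.coe_add, hv', hw', map_add, smul_add]
    abel
  smul_mem' := by
    rintro c p ⟨v, hv, hv'⟩
    refine ⟨c • v, by simp [hv], ?_⟩
    simp only [Prod.smul_snd, Submodule.coe_smul, hv', map_smul, smul_add, smul_comm c μ]

/-- The identity of `X` as an everywhere defined operator: the right-hand side operator of the
pseudo-resolvent equation `d/dt R(μ) w(t) = w(t) + f(t)`, `R(μ) w(0) = R(μ) w₀`. -/
def idOp (X : Type*) [NormedAddCommGroup X] [NormedSpace ℂ X] : X →ₗ.[ℂ] X :=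
  (LinearMap.id : X →ₗ[ℂ] X).toPMap ⊤

end PseudoResolvent

end ADAE

/-!
Write `S = R μ` and `V = closedRange k S`. The rescaled semigroup `U t = exp (-μ t) T t` on `V` is
generated by the operator with graph `{(S v, v) | v ∈ V}`, the inverse of `S` on `V`.

Existence. The generator commutes with the semigroup, so `S (U t v) = U t (S v)`, and the orbit of
`S v` has right derivative `U t v`. Hence `S (U t v) - S v = ∫₀ᵗ U τ v dτ`
(`Generates.map_orbit_sub_eq_integral`). Since orbits are continuous, this integrated equation
makes `w_μ` a solution in each of the three senses.

Uniqueness. Let `z` be the difference of two solutions and `y = S z`. In all three settings `y` is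
continuous and `S (y t) = ∫₀ᵗ y`: for mild solutions by applying `S` to `y t = ∫₀ᵗ z`, for classical
ones by the fundamental theorem of calculus, and for weak ones by testing with `x' ∘ S`, for which
the weak derivative `⟨y, x'⟩` is continuous, so that the du Bois-Reymond lemma
(`HasWeakDerivOn.sub_eq_integral`) applies. Then `y = 0` (`Generates.eq_zero_of_map_eq_integral`):
the function `S ^ k ∘ y` takes values in `V` and solves the same equation, so `S ^ (k + 1) ∘ y = 0`
by uniqueness for the semigroup (`IsC0Semigroup.eq_zero_of_eq_integral`), and the powers of `S` are
removed one at a time because `S ^ (j + 1) (y t)` is the integral of `S ^ j ∘ y`. Finally `z` is the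
(almost everywhere, weak, or classical) derivative of `y = 0`, and therefore vanishes in the
corresponding sense. For weak solutions with values in a separable set, countably many functionals
detect zero, which turns weak equality into equality almost everywhere.
-/

namespace ADAE

/-! ### Primitives of continuous functions -/

section Primitives

theorem intervalIntegrable_of_continuousOn_Icc {E : Type*} [NormedAddCommGroup E] {u : ℝ → E}
    {a b t : ℝ}
    (hu : ContinuousOn u (Icc a b)) (ht : t ∈ Icc a b) : IntervalIntegrable u volume a t :=
  (hu.mono (Icc_subset_Icc_right ht.2)).intervalIntegrable_of_Icc ht.1

variable {E : Type*} [NormedAddCommGroup E] [NormedSpace ℝ E]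

theorem continuousOn_integral_of_continuousOn {u : ℝ → E} {a b : ℝ} (hab : a ≤ b)
    (hu : ContinuousOn u (Icc a b)) :
    ContinuousOn (fun t => ∫ τ in a..t, u τ) (Icc a b) := by
  have h := intervalIntegral.continuousOn_primitive_interval (μ := volume) (f := u) (a := a)
    (b := b) (by rw [uIcc_of_le hab]; exact hu.integrableOn_Icc)
  rwa [uIcc_of_le hab] at h

/-- A right derivative is a limit of difference quotients with positive increments. -/
theorem hasDerivWithinAt_Ici_iff_tendsto {f : ℝ → E} {f' : E} {t : ℝ} :
    HasDerivWithinAt f f' (Ici t) t ↔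
      Tendsto (fun h : ℝ => h⁻¹ • (f (t + h) - f t)) (𝓝[>] 0) (𝓝 f') := by
  rw [← hasDerivWithinAt_Ioi_iff_Ici, hasDerivWithinAt_iff_tendsto_slope' (by simp)]
  have : 𝓝[>] t = map (fun h => t + h) (𝓝[>] 0) := by simp
  rw [this, tendsto_map'_iff]
  simp [Function.comp_def, slope_def_module]

variable [CompleteSpace E]

theorem hasDerivAt_integral_of_continuousOn {u : ℝ → E} {a b t : ℝ}
    (hu : ContinuousOn u (Icc a b)) (ht : t ∈ Ioo a b) :
    HasDerivAt (fun s => ∫ τ in a..s, u τ) (u t) t :=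
  intervalIntegral.integral_hasDerivAt_right
    (intervalIntegrable_of_continuousOn_Icc hu (Ioo_subset_Icc_self ht))
    ((hu.mono Ioo_subset_Icc_self).stronglyMeasurableAtFilter isOpen_Ioo t ht)
    (hu.continuousAt (Icc_mem_nhds ht.1 ht.2))

theorem hasDerivWithinAt_integral_of_continuousOn {u : ℝ → E} {a b t : ℝ}
    (hu : ContinuousOn u (Icc a b)) (ht : t ∈ Ico a b) :
    HasDerivWithinAt (fun s => ∫ τ in a..s, u τ) (u t) (Ici t) t := by
  have hle : 𝓝[>] t ≤ 𝓝[Icc a b] t := by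
    rw [← nhdsWithin_Ioo_eq_nhdsGT ht.2]
    exact nhdsWithin_mono _ fun s hs => ⟨ht.1.trans hs.1.le, hs.2.le⟩
  exact intervalIntegral.integral_hasDerivWithinAt_right
    (intervalIntegrable_of_continuousOn_Icc hu (Ico_subset_Icc_self ht))
    ((hu.stronglyMeasurableAtFilter_nhdsWithin measurableSet_Icc t).filter_mono hle)
    ((hu t (Ico_subset_Icc_self ht)).mono_left hle)

theorem ae_eq_zero_of_forall_integral_eq_zero {z : ℝ → E} {b : ℝ}
    (hz : IntegrableOn z (Icc 0 b)) (h : ∀ t ∈ Icc 0 b, ∫ τ in (0 : ℝ)..t, z τ = 0) :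
    ∀ᵐ t ∂(volume.restrict (Icc 0 b)), z t = 0 := by
  rcases lt_or_ge b 0 with hb | hb
  · simp [Icc_eq_empty hb.not_ge]
  have hint : IntervalIntegrable z volume 0 b :=
    (intervalIntegrable_iff_integrableOn_Icc_of_le hb).2 hz
  rw [Measure.restrict_congr_set Ioo_ae_eq_Icc.symm, ae_restrict_iff' measurableSet_Ioo]
  filter_upwards [hint.ae_hasDerivAt_integral] with t ht hmem
  have h1 := ht (by rw [uIcc_of_le hb]; exact Ioo_subset_Icc_self hmem) 0 left_mem_uIcc
  have h2 : (fun s => ∫ τ in (0 : ℝ)..s, z τ) =ᶠ[𝓝 t] fun _ => 0 := by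
    filter_upwards [Icc_mem_nhds hmem.1 hmem.2] with s hs using h s hs
  exact h1.unique ((hasDerivAt_const t (0 : E)).congr_of_eventuallyEq h2)

theorem eq_zero_of_forall_integral_eq_zero {u : ℝ → E} {b : ℝ} (hb : 0 < b)
    (hu : ContinuousOn u (Icc 0 b)) (h : ∀ t ∈ Icc 0 b, ∫ τ in (0 : ℝ)..t, u τ = 0) :
    ∀ t ∈ Icc 0 b, u t = 0 :=
  Measure.eqOn_Icc_of_ae_eq (μ := volume) hb.ne
    (ae_eq_zero_of_forall_integral_eq_zero hu.integrableOn_Icc h) hu continuousOn_const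

end Primitives

/-! ### Strongly continuous semigroups -/

section Semigroup

variable {V : Type*} [NormedAddCommGroup V] [NormedSpace ℂ V]

theorem IsC0Semigroup.exists_norm_le [CompleteSpace V] {U : ℝ → V →L[ℂ] V}
    (hU : IsC0Semigroup U) (a : ℝ) : ∃ C, ∀ t ∈ Icc 0 a, ‖U t‖ ≤ C := by
  obtain ⟨C, hC⟩ := banach_steinhaus (g := fun t : Icc (0 : ℝ) a => U t) fun x => by
    obtain ⟨C, hC⟩ := isCompact_Icc.exists_bound_of_continuousOn
      ((hU.continuousOn x).mono (Icc_subset_Ici_self : Icc 0 a ⊆ Ici 0))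
    exact ⟨C, fun t => hC t t.2⟩
  exact ⟨C, fun t ht => hC ⟨t, ht⟩⟩

/-- Joint continuity of `(t, x) ↦ U t x` for `t ≥ 0`, a consequence of local boundedness. -/
theorem IsC0Semigroup.tendsto_apply [CompleteSpace V] {U : ℝ → V →L[ℂ] V}
    (hU : IsC0Semigroup U) {ι : Type*} {l : Filter ι} {s : ι → ℝ} {x : ι → V} {t : ℝ} {y : V}
    (ht : 0 ≤ t) (hs₀ : ∀ᶠ i in l, 0 ≤ s i) (hs : Tendsto s l (𝓝 t))
    (hx : Tendsto x l (𝓝 y)) : Tendsto (fun i => U (s i) (x i)) l (𝓝 (U t y)) := by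
  obtain ⟨C, hC⟩ := hU.exists_norm_le (t + 1)
  have h1 : Tendsto (fun i => U (s i) y) l (𝓝 (U t y)) :=
    (hU.continuousOn y t ht).tendsto.comp (tendsto_nhdsWithin_iff.2 ⟨hs, hs₀⟩)
  have h2 : Tendsto (fun i => U (s i) (x i - y)) l (𝓝 0) := by
    refine squeeze_zero_norm' (a := fun i => C * ‖x i - y‖) ?_ ?_
    · filter_upwards [hs₀, hs.eventually (gt_mem_nhds (lt_add_one t))] with i hi hi'
      exact (U (s i)).le_of_opNorm_le (hC _ ⟨hi, hi'.le⟩) _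
    · simpa using ((hx.sub_const y).norm).const_mul C
  simpa using h2.add h1

theorem IsC0Semigroup.continuousOn_apply [CompleteSpace V] {U : ℝ → V →L[ℂ] V}
    (hU : IsC0Semigroup U) {s : ℝ → ℝ} {x : ℝ → V} {D : Set ℝ} (hs₀ : ∀ t ∈ D, 0 ≤ s t)
    (hs : ContinuousOn s D) (hx : ContinuousOn x D) :
    ContinuousOn (fun t => U (s t) (x t)) D := fun t ht =>
  hU.tendsto_apply (hs₀ t ht) (eventually_mem_nhdsWithin.mono hs₀) (hs t ht) (hx t ht)

theorem IsC0Semigroup.hasDerivWithinAt_orbit {U : ℝ → V →L[ℂ] V} (hU : IsC0Semigroup U)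
    {x y : V} (hxy : Tendsto (fun h : ℝ => h⁻¹ • (U h x - x)) (𝓝[>] 0) (𝓝 y)) {t : ℝ}
    (ht : 0 ≤ t) : HasDerivWithinAt (fun s => U s x) (U t y) (Ici t) t := by
  rw [hasDerivWithinAt_Ici_iff_tendsto]
  refine (((U t).continuous.tendsto y).comp hxy).congr' ?_
  filter_upwards [self_mem_nhdsWithin] with h hh
  have hh : 0 < h := hh
  simp [hU.add t h ht hh.le, ← Complex.coe_smul]

theorem IsC0Semigroup.orbit_sub_eq_integral [CompleteSpace V] {U : ℝ → V →L[ℂ] V}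
    (hU : IsC0Semigroup U) {x y : V}
    (hxy : Tendsto (fun h : ℝ => h⁻¹ • (U h x - x)) (𝓝[>] 0) (𝓝 y)) {t : ℝ} (ht : 0 ≤ t) :
    U t x - x = ∫ τ in (0 : ℝ)..t, U τ y := by
  have hy : ContinuousOn (fun τ => U τ y) (Icc 0 t) :=
    (hU.continuousOn y).mono Icc_subset_Ici_self
  have h := constant_of_has_deriv_right_zero
    (f := fun s => U s x - ∫ τ in (0 : ℝ)..s, U τ y) (a := 0) (b := t)
    (((hU.continuousOn x).mono Icc_subset_Ici_self).sub
      (continuousOn_integral_of_continuousOn ht hy))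
    (fun s hs => by
      simpa using (hU.hasDerivWithinAt_orbit hxy hs.1).fun_sub
        (hasDerivWithinAt_integral_of_continuousOn hy hs)) t (right_mem_Icc.2 ht)
  simp only [hU.zero, ContinuousLinearMap.id_apply, intervalIntegral.integral_same,
    sub_zero] at h
  exact sub_eq_iff_eq_add.2 (sub_eq_iff_eq_add'.1 h)

/-- Uniqueness for the abstract Cauchy problem: if `(S v, v)` belongs to the generator for all
`v`, then `p = S u` solves `p' = B p`, `p 0 = 0`, and vanishes because `s ↦ U (t - s) (p s)` has
right derivative zero. -/
theorem IsC0Semigroup.eq_zero_of_eq_integral [CompleteSpace V] {U : ℝ → V →L[ℂ] V}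
    (hU : IsC0Semigroup U) {S : V →L[ℂ] V}
    (hS : ∀ v, Tendsto (fun h : ℝ => h⁻¹ • (U h (S v) - S v)) (𝓝[>] 0) (𝓝 v))
    {u : ℝ → V} {b : ℝ} (hu : ContinuousOn u (Icc 0 b))
    (h : ∀ t ∈ Icc 0 b, S (u t) = ∫ τ in (0 : ℝ)..t, u τ) :
    ∀ t ∈ Icc 0 b, S (u t) = 0 := by
  intro t ht
  have hp : ContinuousOn (fun s => S (u s)) (Icc 0 t) :=
    S.continuous.comp_continuousOn (hu.mono (Icc_subset_Icc_right ht.2))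
  have key := constant_of_has_deriv_right_zero (f := fun s => U (t - s) (S (u s)))
    (a := 0) (b := t)
    (hU.continuousOn_apply (fun s hs => sub_nonneg.2 hs.2) (by fun_prop) hp)
    (fun s hs => ?_) t (right_mem_Icc.2 ht.1)
  · have h0 : S (u 0) = 0 := by simpa using h 0 (left_mem_Icc.2 (ht.1.trans ht.2))
    simpa [hU.zero, h0] using key
  have hsb : s ∈ Ico 0 b := ⟨hs.1, hs.2.trans_le ht.2⟩
  have hd : Tendsto (fun r : ℝ => r⁻¹ • (S (u (s + r)) - S (u s))) (𝓝[>] 0) (𝓝 (u s)) := by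
    refine (hasDerivWithinAt_Ici_iff_tendsto.1
      (hasDerivWithinAt_integral_of_continuousOn hu hsb)).congr' ?_
    filter_upwards [Ioo_mem_nhdsGT (sub_pos.2 hsb.2)] with r hr
    rw [h (s + r) ⟨by linarith [hs.1, hr.1], by linarith [hr.2]⟩,
      h s (Ico_subset_Icc_self hsb)]
  rw [hasDerivWithinAt_Ici_iff_tendsto]
  have hnn : ∀ᶠ r : ℝ in 𝓝[>] 0, 0 ≤ t - (s + r) := by
    filter_upwards [Ioo_mem_nhdsGT (sub_pos.2 hs.2)] with r hr
    linarith [hr.2]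
  have hlim : Tendsto (fun r : ℝ => t - (s + r)) (𝓝[>] 0) (𝓝 (t - s)) := by
    have : Continuous fun r : ℝ => t - (s + r) := by fun_prop
    simpa using (this.tendsto 0).mono_left nhdsWithin_le_nhds
  -- Product rule: `U (t - s - r)` applied to the difference of the quotients of `p` and of the
  -- orbit of `p s`, both of which converge to `u s`.
  have hmain := hU.tendsto_apply (sub_nonneg.2 hs.2.le) hnn hlim (hd.sub (hS (u s)))
  rw [sub_self, map_zero] at hmain
  refine hmain.congr' ?_
  filter_upwards [hnn, self_mem_nhdsWithin] with r hr hr'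
  have hr' : 0 < r := hr'
  have hsplit : U (t - s) (S (u s)) = U (t - (s + r)) (U r (S (u s))) := by
    rw [show t - s = t - (s + r) + r by ring, hU.add _ _ hr hr'.le]
    simp
  rw [hsplit, ← smul_sub, sub_sub_sub_cancel_right, ← Complex.coe_smul, ← Complex.coe_smul,
    map_smul, map_sub]

/-- Multiplying a semigroup by `exp (-μ t)` subtracts `μ` from its generator. -/
theorem IsC0Semigroup.rescale {T : ℝ → V →L[ℂ] V} (hT : IsC0Semigroup T) (μ : ℂ) :
    IsC0Semigroup fun t : ℝ => Complex.exp (-μ * t) • T t where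
  zero := by simp [hT.zero]
  add s t hs ht := by
    ext x
    simp [hT.add s t hs ht, mul_add, Complex.exp_add, smul_smul, mul_comm]
  continuousOn x := by
    have := hT.continuousOn x
    simp only [_root_.smul_apply]
    fun_prop

theorem tendsto_rescale {T : ℝ → V →L[ℂ] V} (μ : ℂ) {x y : V}
    (h : Tendsto (fun h : ℝ => h⁻¹ • (T h x - x)) (𝓝[>] 0) (𝓝 (y + μ • x))) :
    Tendsto (fun h : ℝ => h⁻¹ • ((Complex.exp (-μ * h) • T h) x - x)) (𝓝[>] 0) (𝓝 y) := by
  have hd : HasDerivAt (fun r : ℝ => Complex.exp (-μ * r)) (-μ) 0 := by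
    have h1 : HasDerivAt (fun r : ℝ => -μ * (r : ℂ)) (-μ) 0 := by
      simpa using (Complex.ofRealCLM.hasDerivAt (x := 0)).const_mul (-μ)
    simpa using h1.cexp
  have h2 := hasDerivWithinAt_Ici_iff_tendsto.1 (hd.hasDerivWithinAt (s := Ici 0))
  have h3 : Tendsto (fun r : ℝ => Complex.exp (-μ * r)) (𝓝[>] 0) (𝓝 1) := by
    simpa using hd.continuousAt.tendsto.mono_left nhdsWithin_le_nhds
  have h4 := (h3.smul h).add (h2.smul_const x)
  have e : (1 : ℂ) • (y + μ • x) + (-μ) • x = y := by simp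
  rw [e] at h4
  refine h4.congr fun r => ?_
  simp only [zero_add, Complex.ofReal_zero, mul_zero, Complex.exp_zero,
    _root_.smul_apply, ← Complex.coe_smul, smul_eq_mul, smul_sub, smul_smul,
    sub_smul, mul_one]
  rw [mul_comm (Complex.exp _)]
  abel

end Semigroup

/-! ### Weak derivatives -/

section WeakDeriv

theorem HasWeakDerivOn.sub {u₁ u₂ g₁ g₂ : ℝ → ℂ} {a b : ℝ} (h₁ : HasWeakDerivOn u₁ g₁ a b)
    (h₂ : HasWeakDerivOn u₂ g₂ a b) :
    HasWeakDerivOn (fun t => u₁ t - u₂ t) (fun t => g₁ t - g₂ t) a b where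
  integrable := h₁.integrable.sub h₂.integrable
  integrable_deriv := h₁.integrable_deriv.sub h₂.integrable_deriv
  integral_eq φ hφ hc hs := by
    have hi : ∀ (ψ : ℝ → ℝ) (v : ℝ → ℂ), Continuous ψ → IntegrableOn v (Icc a b) →
        IntegrableOn (fun t => ψ t • v t) (Icc a b) := fun ψ v hψ hv =>
      hv.continuousOn_smul hψ.continuousOn isCompact_Icc
    have hφ' : Continuous (deriv φ) := hφ.continuous_deriv (by simp)
    simp only [smul_sub]
    rw [integral_sub (hi _ _ hφ' h₁.integrable) (hi _ _ hφ' h₂.integrable),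
      integral_sub (hi _ _ hφ.continuous h₁.integrable_deriv)
        (hi _ _ hφ.continuous h₂.integrable_deriv),
      h₁.integral_eq φ hφ hc hs, h₂.integral_eq φ hφ hc hs]
    ring

theorem hasWeakDerivOn_of_hasDerivAt {u g : ℝ → ℂ} {a b : ℝ} (hab : a ≤ b)
    (hu : ContinuousOn u (Icc a b)) (hg : ContinuousOn g (Icc a b))
    (h : ∀ t ∈ Ioo a b, HasDerivAt u (g t) t) : HasWeakDerivOn u g a b where
  integrable := hu.integrableOn_Icc
  integrable_deriv := hg.integrableOn_Icc
  integral_eq φ hφ hc hs := by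
    have hφ' : Continuous (deriv φ) := hφ.continuous_deriv (by simp)
    have hφ₀ : Continuous φ := hφ.continuous
    have c1 : ContinuousOn (fun t => deriv φ t • u t) (Icc a b) := by fun_prop
    have c2 : ContinuousOn (fun t => φ t • g t) (Icc a b) := by fun_prop
    have hzero : ∀ t ∉ Ioo a b, φ t = 0 := fun t ht => image_eq_zero_of_notMem_tsupport
      fun h' => ht (hs h')
    have key := intervalIntegral.integral_eq_sub_of_hasDerivAt_of_le
      (f := fun t => φ t • u t) (f' := fun t => φ t • g t + deriv φ t • u t) hab
      (by fun_prop)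
      (fun t ht => ((hφ.differentiable (by simp)) t).hasDerivAt.smul (h t ht))
      ((c2.add c1).intervalIntegrable_of_Icc hab)
    rw [hzero a (by simp), hzero b (by simp), intervalIntegral.integral_of_le hab,
      ← integral_Icc_eq_integral_Ioc, integral_add c2.integrableOn_Icc c1.integrableOn_Icc]
      at key
    simp only [zero_smul, sub_self] at key
    linear_combination key

/-- A smooth function with integral zero and support in a compact subset of `(a, b)` has a
primitive that is again a test function on `(a, b)`. -/
theorem exists_testFunction_deriv_eq {q : ℝ → ℝ} {a b : ℝ} (hq : ContDiff ℝ ∞ q) {K : Set ℝ}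
    (hK : IsCompact K) (hKab : K ⊆ Ioo a b) (hqK : ∀ t ∉ K, q t = 0) (hq₀ : ∫ t, q t = 0) :
    ∃ φ : ℝ → ℝ, ContDiff ℝ ∞ φ ∧ HasCompactSupport φ ∧ tsupport φ ⊆ Ioo a b ∧
      deriv φ = q := by
  rcases K.eq_empty_or_nonempty with rfl | hne
  · obtain rfl : q = 0 := by ext t; exact hqK t (by simp)
    exact ⟨0, contDiff_const, HasCompactSupport.zero, by simp [tsupport], by ext; simp⟩
  obtain ⟨c, hc⟩ := hK.exists_isLeast hne
  obtain ⟨d, hd⟩ := hK.exists_isGreatest hne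
  have hder : ∀ t, HasDerivAt (fun s => ∫ τ in a..s, q τ) (q t) t := fun t =>
    intervalIntegral.integral_hasDerivAt_right (hq.continuous.intervalIntegrable _ _)
      (hq.continuous.stronglyMeasurableAtFilter _ _) hq.continuous.continuousAt
  have hderiv : deriv (fun s => ∫ τ in a..s, q τ) = q := funext fun t => (hder t).deriv
  have hsupp : Function.support (fun s => ∫ τ in a..s, q τ) ⊆ Icc c d := by
    intro t ht
    by_contra hcd
    refine ht ?_
    rcases lt_or_ge t c with htc | htc
    · refine intervalIntegral.integral_zero_ae (Eventually.of_forall fun x hx => hqK x ?_)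
      intro hxK
      have h1 := hc.2 hxK
      have h2 : x ≤ max a t := hx.2
      have h3 : a < c := (hKab hc.1).1
      exact absurd (h1.trans h2) (not_le.2 (max_lt h3 htc))
    · have htd : d < t := not_le.1 fun h => hcd ⟨htc, h⟩
      change ∫ τ in a..t, q τ = 0
      rw [intervalIntegral.integral_eq_integral_of_support_subset, hq₀]
      intro x hx
      have hxK : x ∈ K := not_imp_comm.1 (hqK x) hx
      exact ⟨(hKab hxK).1, (hd.2 hxK).trans htd.le⟩
  refine ⟨fun s => ∫ τ in a..s, q τ, ?_, HasCompactSupport.of_support_subset_isCompact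
    isCompact_Icc hsupp, (closure_minimal hsupp isClosed_Icc).trans
      (Icc_subset_Ioo (hKab hc.1).1 (hKab hd.1).2), hderiv⟩
  rw [contDiff_infty_iff_deriv, hderiv]
  exact ⟨fun t => (hder t).differentiableAt, hq⟩

/-- The du Bois-Reymond lemma. -/
theorem eq_of_forall_integral_deriv_smul_eq_zero {h : ℝ → ℂ} {a b : ℝ} (hab : a < b)
    (hh : ContinuousOn h (Icc a b))
    (H : ∀ φ : ℝ → ℝ, ContDiff ℝ ∞ φ → HasCompactSupport φ → tsupport φ ⊆ Ioo a b →
      ∫ t in Icc a b, deriv φ t • h t = 0) :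
    ∀ t ∈ Icc a b, h t = h a := by
  have hball : Metric.closedBall ((a + b) / 2) ((b - a) / 4) ⊆ Ioo a b := by
    rw [Real.closedBall_eq_Icc]
    exact Icc_subset_Ioo (by linarith) (by linarith)
  let f : ContDiffBump ((a + b) / 2 : ℝ) :=
    ⟨(b - a) / 8, (b - a) / 4, by linarith, by linarith⟩
  obtain ⟨ρ, hρ, hρc, hρs, hρi⟩ : ∃ ρ : ℝ → ℝ, ContDiff ℝ ∞ ρ ∧ HasCompactSupport ρ ∧
      tsupport ρ ⊆ Ioo a b ∧ ∫ t, ρ t = 1 :=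
    ⟨f.normed volume, f.contDiff_normed, f.hasCompactSupport_normed,
      f.tsupport_normed_eq.subset.trans hball, f.integral_normed⟩
  have hint : ∀ ψ : ℝ → ℝ, Continuous ψ → IntegrableOn (fun t => ψ t • h t) (Icc a b) :=
    fun ψ hψ => ContinuousOn.integrableOn_Icc (by fun_prop)
  set c : ℂ := ∫ t in Icc a b, ρ t • h t with hc
  have hae : ∀ᵐ t, t ∈ Ioo a b → h t - c = 0 := by
    refine isOpen_Ioo.ae_eq_zero_of_integral_contDiff_smul_eq_zero
      (((hh.mono Ioo_subset_Icc_self).sub continuousOn_const).locallyIntegrableOn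
        measurableSet_Ioo) fun ψ hψ hψc hψs => ?_
    -- Subtracting `(∫ ψ) ρ` makes the integral of `ψ` vanish.
    obtain ⟨φ, hφ, hφc, hφs, hφd⟩ := exists_testFunction_deriv_eq
      (q := fun t => ψ t - (∫ τ, ψ τ) * ρ t) (a := a) (b := b)
      (hψ.sub (contDiff_const.mul hρ)) (hψc.isCompact.union hρc.isCompact)
      (union_subset hψs hρs)
      (fun t ht => by
        rw [mem_union, not_or] at ht
        simp [image_eq_zero_of_notMem_tsupport ht.1, image_eq_zero_of_notMem_tsupport ht.2])
      (by
        rw [integral_sub (hψ.continuous.integrable_of_hasCompactSupport hψc)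
          ((hρ.continuous.integrable_of_hasCompactSupport hρc).const_mul _),
          integral_const_mul, hρi]
        simp)
    have h0 := H φ hφ hφc hφs
    rw [hφd] at h0
    simp only [sub_smul, mul_smul] at h0
    rw [integral_sub (hint _ hψ.continuous) ((hint _ hρ.continuous).fun_smul _), integral_smul,
      ← hc] at h0
    have hz : ∀ t ∉ Icc a b, ψ t = 0 := fun t ht =>
      image_eq_zero_of_notMem_tsupport fun h' => ht (Ioo_subset_Icc_self (hψs h'))
    rw [← setIntegral_eq_integral_of_forall_compl_eq_zero (s := Icc a b)
      (fun t ht => by rw [hz t ht, zero_smul])]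
    simp only [smul_sub]
    rw [integral_sub (hint _ hψ.continuous) (ContinuousOn.integrableOn_Icc
      (hψ.continuous.fun_smul continuous_const).continuousOn), integral_smul_const,
      setIntegral_eq_integral_of_forall_compl_eq_zero hz]
    exact h0
  have hEq : EqOn h (fun _ => c) (Icc a b) := by
    refine Measure.eqOn_Icc_of_ae_eq (μ := volume) hab.ne ?_ hh continuousOn_const
    rw [Measure.restrict_congr_set Ioo_ae_eq_Icc.symm]
    refine (ae_restrict_iff' measurableSet_Ioo).2 (hae.mono fun t ht hm => ?_)
    exact sub_eq_zero.1 (ht hm)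
  intro t ht
  rw [hEq ht, hEq (left_mem_Icc.2 hab.le)]

theorem HasWeakDerivOn.sub_eq_integral {u g : ℝ → ℂ} {a b : ℝ} (hab : a < b)
    (h : HasWeakDerivOn u g a b) (hu : ContinuousOn u (Icc a b))
    (hg : ContinuousOn g (Icc a b)) :
    ∀ t ∈ Icc a b, u t - u a = ∫ τ in a..t, g τ := by
  have hG := continuousOn_integral_of_continuousOn hab.le hg
  have hw := h.sub (hasWeakDerivOn_of_hasDerivAt hab.le hG hg
    fun t ht => hasDerivAt_integral_of_continuousOn hg ht)
  intro t ht
  have := eq_of_forall_integral_deriv_smul_eq_zero hab (hu.sub hG)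
    (fun φ h1 h2 h3 => by simpa using hw.integral_eq φ h1 h2 h3) t ht
  simp only [Pi.sub_apply, intervalIntegral.integral_same, sub_zero] at this
  linear_combination this

/-- The weak derivative of the zero function vanishes almost everywhere. -/
theorem HasWeakDerivOn.ae_eq_zero {u g : ℝ → ℂ} {a b : ℝ} (h : HasWeakDerivOn u g a b)
    (hu : ∀ t ∈ Icc a b, u t = 0) : ∀ᵐ t ∂(volume.restrict (Icc a b)), g t = 0 := by
  rw [Measure.restrict_congr_set Ioo_ae_eq_Icc.symm, ae_restrict_iff' measurableSet_Ioo]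
  refine isOpen_Ioo.ae_eq_zero_of_integral_contDiff_smul_eq_zero
    (h.integrable_deriv.mono_set Ioo_subset_Icc_self).locallyIntegrableOn
    fun φ hφ hφc hφs => ?_
  have h1 := h.integral_eq φ hφ hφc hφs
  rw [setIntegral_congr_fun (g := fun _ => (0 : ℂ)) measurableSet_Icc
    (fun t ht => by simp [hu t ht]), integral_zero] at h1
  rw [← setIntegral_eq_integral_of_forall_compl_eq_zero (s := Icc a b)]
  · exact neg_eq_zero.1 h1.symm
  · intro t ht
    rw [image_eq_zero_of_notMem_tsupport fun h' => ht (Ioo_subset_Icc_self (hφs h')),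
      zero_smul]

end WeakDeriv


/-! ### The semigroup on `closedRange k S` -/

section ClosedRange

variable {X : Type*} [NormedAddCommGroup X] [NormedSpace ℂ X] {k : ℕ} {μ : ℂ} {S : X →L[ℂ] X}

theorem map_mem_closedRange {v : X} (hv : v ∈ closedRange k S) : S v ∈ closedRange k S := by
  have h : MapsTo S ((S ^ k).range : Set X) ((S ^ k).range : Set X) := by
    rintro _ ⟨x, rfl⟩
    refine ⟨S x, ?_⟩
    change (S ^ k * S) x = (S * S ^ k) x
    rw [← pow_succ, ← pow_succ']
  exact h.closure S.continuous hv

variable (k S) in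
/-- The restriction of `S` to the invariant subspace `closedRange k S`. -/
def restrictClosedRange : closedRange k S →L[ℂ] closedRange k S :=
  (S.comp (closedRange k S).subtypeL).codRestrict _ fun v => map_mem_closedRange v.2

@[simp]
theorem coe_restrictClosedRange (v : closedRange k S) : (restrictClosedRange k S v : X) = S v :=
  rfl

variable {T : ℝ → closedRange k S →L[ℂ] closedRange k S}

/-- The rescaled semigroup `exp (-μ t) T t` is generated by the inverse of `S`. -/
theorem Generates.tendsto_exp_smul (hT : Generates (graphAR k μ S) T) (v : closedRange k S) :
    Tendsto (fun h : ℝ => h⁻¹ • ((Complex.exp (-μ * h) • T h) (restrictClosedRange k S v)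
      - restrictClosedRange k S v)) (𝓝[>] 0) (𝓝 v) :=
  tendsto_rescale μ ((hT.2 _ (v + μ • restrictClosedRange k S v)).1 ⟨v, rfl, rfl⟩)

theorem Generates.map_commute (hT : Generates (graphAR k μ S) T) {t : ℝ} (ht : 0 ≤ t)
    (v : closedRange k S) : S (T t v) = T t (restrictClosedRange k S v) := by
  have h1 := (hT.2 (restrictClosedRange k S v) (v + μ • restrictClosedRange k S v)).1
    ⟨v, rfl, rfl⟩
  have h2 := ((T t).continuous.tendsto _).comp h1
  -- The generator commutes with `T t`, so `T t` maps the graph of `A_R` into itself.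
  obtain ⟨v', hv₁, hv₂⟩ := (hT.2 (T t (restrictClosedRange k S v))
    (T t (v + μ • restrictClosedRange k S v))).2 <| by
      refine h2.congr' ?_
      filter_upwards [self_mem_nhdsWithin] with h hh
      have hh : 0 < h := hh
      have hc : T h (T t (restrictClosedRange k S v)) =
          T t (T h (restrictClosedRange k S v)) := by
        rw [← ContinuousLinearMap.comp_apply (T h),
          ← hT.1.add h t hh.le ht, add_comm, hT.1.add t h ht hh.le]
        rfl
      simp only [Function.comp_apply, ← Complex.coe_smul, map_smul, map_sub, hc]
  have hv : (T t v : X) = v' := by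
    replace hv₁ : (T t (restrictClosedRange k S v) : X) = S v' := hv₁
    replace hv₂ : (T t (v + μ • restrictClosedRange k S v) : X) = v' + μ • S v' := hv₂
    rw [map_add, map_smul, Submodule.coe_add, Submodule.coe_smul, hv₁] at hv₂
    exact add_right_cancel hv₂
  rw [hv₁, hv]

theorem Generates.continuousOn_orbit (hT : Generates (graphAR k μ S) T)
    (v : closedRange k S) :
    ContinuousOn (fun t : ℝ => Complex.exp (-μ * t) • (T t v : X)) (Ici 0) :=
  (continuous_subtype_val.comp_continuousOn ((hT.1.rescale μ).continuousOn v))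

variable [CompleteSpace X]

instance : CompleteSpace (closedRange k S) :=
  (Submodule.isClosed_topologicalClosure _).completeSpace_coe

/-- The orbits of the rescaled semigroup solve the integrated equation. -/
theorem Generates.map_orbit_sub_eq_integral (hT : Generates (graphAR k μ S) T)
    (v : closedRange k S) {t : ℝ} (ht : 0 ≤ t) :
    S (Complex.exp (-μ * t) • (T t v : X)) - S v =
      ∫ τ in (0 : ℝ)..t, Complex.exp (-μ * τ) • (T τ v : X) := by
  have hU := hT.1.rescale μ
  have h := congrArg (closedRange k S).subtypeL
    (hU.orbit_sub_eq_integral (hT.tendsto_exp_smul v) ht)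
  rw [← ContinuousLinearMap.intervalIntegral_comp_comm _
    (((hU.continuousOn v).mono Icc_subset_Ici_self).intervalIntegrable_of_Icc ht)] at h
  simpa [hT.map_commute ht] using h

/-- Uniqueness for continuous solutions of the integrated equation in `X`. As `S ^ k ∘ y` solves
the same equation inside `closedRange k S`, uniqueness for the semigroup gives
`S ^ (k + 1) ∘ y = 0`. The factors `S` are then removed one by one, since `S ^ (j + 1) (y t)` is
the integral of `S ^ j ∘ y` over `[0, t]`. -/
theorem Generates.eq_zero_of_map_eq_integral (hT : Generates (graphAR k μ S) T) {y : ℝ → X}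
    {b : ℝ} (hb : 0 < b) (hy : ContinuousOn y (Icc 0 b))
    (h : ∀ t ∈ Icc 0 b, S (y t) = ∫ τ in (0 : ℝ)..t, y τ) : ∀ t ∈ Icc 0 b, y t = 0 := by
  have hc (j : ℕ) : ContinuousOn (fun t => (S ^ j) (y t)) (Icc 0 b) :=
    (S ^ j).continuous.comp_continuousOn hy
  have hint (j : ℕ) : ∀ t ∈ Icc 0 b,
      (S ^ (j + 1)) (y t) = ∫ τ in (0 : ℝ)..t, (S ^ j) (y τ) := fun t ht => by
    rw [ContinuousLinearMap.intervalIntegral_comp_comm _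
      (intervalIntegrable_of_continuousOn_Icc hy ht), ← h t ht, pow_succ]
    rfl
  have hdesc (j : ℕ) : (∀ t ∈ Icc 0 b, (S ^ j) (y t) = 0) → ∀ t ∈ Icc 0 b, y t = 0 := by
    induction j with
    | zero => exact fun h0 => by simpa using h0
    | succ j ih =>
      exact fun h0 => ih (eq_zero_of_forall_integral_eq_zero hb (hc j)
        fun t ht => by rw [← hint j t ht, h0 t ht])
  refine hdesc (k + 1) fun t ht => ?_
  have hmem (x : X) : (S ^ k) x ∈ closedRange k S :=
    Submodule.le_topologicalClosure _ ⟨x, rfl⟩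
  have hu : ContinuousOn (fun t => (⟨(S ^ k) (y t), hmem _⟩ : closedRange k S)) (Icc 0 b) :=
    Topology.IsInducing.subtypeVal.continuousOn_iff.2 (hc k)
  have hz := (hT.1.rescale μ).eq_zero_of_eq_integral hT.tendsto_exp_smul hu (fun t ht => by
    refine Subtype.ext ?_
    have e := ContinuousLinearMap.intervalIntegral_comp_comm (closedRange k S).subtypeL
      (intervalIntegrable_of_continuousOn_Icc hu ht)
    refine Eq.trans ?_ e
    refine Eq.trans ?_ (hint k t ht)
    rw [pow_succ']
    rfl) t ht
  rw [pow_succ']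
  exact congrArg Subtype.val hz

end ClosedRange

/-! ### Solutions of the pseudo-resolvent equation -/

section Solutions

variable {X : Type*} [NormedAddCommGroup X] [NormedSpace ℂ X] {S : X →L[ℂ] X}
  {w₀ : X} {tf : ℝ} {w : ℝ → X}

theorem dualApplies_idOp_iff {z' x' : StrongDual ℂ X} : DualApplies (idOp X) z' x' ↔ x' = z' :=
  ⟨fun h => ContinuousLinearMap.ext fun x => h ⟨x, Submodule.mem_top⟩, fun h x => by
    rw [h]; rfl⟩

/-- By continuity of `S ∘ w`, the integrated equation of a mild solution holds at every time. -/
theorem IsMildSolution.map_sub_eq_integral [CompleteSpace X] (htf : 0 < tf)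
    (hw : IsMildSolution (S : X →ₗ[ℂ] X) (idOp X) (fun _ => 0) w₀ tf w) :
    ∀ t ∈ Icc 0 tf, S (w t) - S w₀ = ∫ τ in (0 : ℝ)..t, w τ := by
  have hprim := intervalIntegral.continuousOn_primitive_interval (μ := volume) (f := w)
    (a := 0) (b := tf) (by rw [uIcc_of_le htf.le]; exact hw.integrable)
  rw [uIcc_of_le htf.le] at hprim
  refine Measure.eqOn_Icc_of_ae_eq (μ := volume) htf.ne ?_
    (hw.continuousOn.sub continuousOn_const) hprim
  filter_upwards [hw.equation] with t ht
  obtain ⟨h, ht⟩ := ht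
  simpa [idOp] using ht

theorem IsWeakSolution.hasWeakDerivOn
    (hw : IsWeakSolution (S : X →ₗ[ℂ] X) (idOp X) (fun _ => 0) w₀ tf w) (x' : StrongDual ℂ X) :
    HasWeakDerivOn (fun t => x' (S (w t))) (fun t => x' (w t)) 0 tf := by
  simpa using hw.equation x' x' (dualApplies_idOp_iff.2 rfl)

theorem isMildSolution_of_map_sub_eq_integral (hw : ContinuousOn w (Icc 0 tf))
    (h : ∀ t ∈ Icc 0 tf, S (w t) - S w₀ = ∫ τ in (0 : ℝ)..t, w τ) :
    IsMildSolution (S : X →ₗ[ℂ] X) (idOp X) (fun _ => 0) w₀ tf w where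
  integrable_rhs := integrableOn_zero
  continuousOn := S.continuous.comp_continuousOn hw
  integrable := hw.integrableOn_Icc
  equation := (ae_restrict_iff' measurableSet_Icc).2 <| Eventually.of_forall fun t ht =>
    ⟨Submodule.mem_top, by simpa [idOp] using h t ht⟩

variable [CompleteSpace X]

theorem hasDerivAt_map_of_map_sub_eq_integral (hw : ContinuousOn w (Icc 0 tf))
    (h : ∀ t ∈ Icc 0 tf, S (w t) - S w₀ = ∫ τ in (0 : ℝ)..t, w τ) {t : ℝ}
    (ht : t ∈ Ioo 0 tf) : HasDerivAt (fun s => S (w s)) (w t) t := by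
  refine ((hasDerivAt_integral_of_continuousOn hw ht).add_const (S w₀)).congr_of_eventuallyEq ?_
  filter_upwards [Icc_mem_nhds ht.1 ht.2] with s hs
  rw [← h s hs, sub_add_cancel]

theorem isWeakSolution_of_map_sub_eq_integral (htf : 0 ≤ tf) (hw : ContinuousOn w (Icc 0 tf))
    (h : ∀ t ∈ Icc 0 tf, S (w t) - S w₀ = ∫ τ in (0 : ℝ)..t, w τ) :
    IsWeakSolution (S : X →ₗ[ℂ] X) (idOp X) (fun _ => 0) w₀ tf w := by
  have hd (x' : StrongDual ℂ X) :
      HasWeakDerivOn (fun t => x' (S (w t))) (fun t => x' (w t)) 0 tf :=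
    hasWeakDerivOn_of_hasDerivAt htf
      ((x'.comp S).continuous.comp_continuousOn hw) (x'.continuous.comp_continuousOn hw)
      fun t ht => ((x'.restrictScalars ℝ).hasFDerivAt.comp_hasDerivAt t
        (hasDerivAt_map_of_map_sub_eq_integral hw h ht))
  exact
  { dense_domain := by simp [idOp]
    continuousOn := S.continuous.comp_continuousOn hw
    initial := sub_eq_zero.1 <| by simpa using h 0 (left_mem_Icc.2 htf)
    integrable_rhs := fun z' => by simp
    sobolev := fun z' => ⟨_, hd z'⟩
    equation := fun z' x' hz => by
      rw [dualApplies_idOp_iff] at hz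
      simpa [hz] using hd z' }

/-- A continuous `w` is the derivative of `S ∘ w` once it solves the integrated equation, so
`S ∘ w` is then automatically continuously differentiable. -/
theorem isClassicalSolution_of_map_sub_eq_integral (htf : 0 ≤ tf)
    (hw : ContinuousOn w (Icc 0 tf))
    (h : ∀ t ∈ Icc 0 tf, S (w t) - S w₀ = ∫ τ in (0 : ℝ)..t, w τ) :
    IsClassicalSolution (S : X →ₗ[ℂ] X) (idOp X) (fun _ => 0) w₀ tf w := by
  have hd := fun t ht => hasDerivAt_map_of_map_sub_eq_integral (t := t) hw h ht
  exact
  { continuousOn := S.continuous.comp_continuousOn hw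
    contDiffOn := by
      rw [show (1 : WithTop ℕ∞) = 0 + 1 from rfl, contDiffOn_succ_iff_deriv_of_isOpen isOpen_Ioo]
      refine ⟨fun t ht => (hd t ht).differentiableAt.differentiableWithinAt, by simp, ?_⟩
      rw [contDiffOn_zero]
      exact (hw.mono Ioo_subset_Icc_self).congr fun t ht => (hd t ht).deriv
    initial := sub_eq_zero.1 <| by simpa using h 0 (left_mem_Icc.2 htf)
    equation := fun t ht => ⟨Submodule.mem_top, by simpa [idOp] using hd t ht⟩ }

end Solutions

/-! ### Uniqueness -/

section Uniqueness

variable {X : Type*} [NormedAddCommGroup X] [NormedSpace ℂ X] [CompleteSpace X] {k : ℕ} {μ : ℂ}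
  {S : X →L[ℂ] X} {T : ℝ → closedRange k S →L[ℂ] closedRange k S} {tf : ℝ} {w₀ : X}
  {w w' : ℝ → X}

theorem Generates.mild_unique (hT : Generates (graphAR k μ S) T) (htf : 0 < tf)
    (hw : IsMildSolution (S : X →ₗ[ℂ] X) (idOp X) (fun _ => 0) w₀ tf w)
    (hw' : IsMildSolution (S : X →ₗ[ℂ] X) (idOp X) (fun _ => 0) w₀ tf w') :
    (∀ t ∈ Icc 0 tf, S (w t) = S (w' t)) ∧
      ∀ᵐ t ∂(volume.restrict (Icc 0 tf)), w t = w' t := by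
  have hi {v : ℝ → X} (hv : IntegrableOn v (Icc 0 tf)) {t : ℝ} (ht : t ∈ Icc 0 tf) :
      IntervalIntegrable v volume 0 t :=
    (intervalIntegrable_iff_integrableOn_Icc_of_le ht.1).2
      (hv.mono_set (Icc_subset_Icc_right ht.2))
  have hz : ∀ t ∈ Icc 0 tf, S (w t - w' t) = ∫ τ in (0 : ℝ)..t, (w τ - w' τ) :=
    fun t ht => by
      rw [intervalIntegral.integral_sub (hi hw.integrable ht) (hi hw'.integrable ht),
        ← hw.map_sub_eq_integral htf t ht, ← hw'.map_sub_eq_integral htf t ht, map_sub]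
      abel
  have hc : ContinuousOn (fun t => S (w t - w' t)) (Icc 0 tf) := by
    simpa using hw.continuousOn.fun_sub hw'.continuousOn
  have h0 := hT.eq_zero_of_map_eq_integral htf hc fun t ht => by
    rw [ContinuousLinearMap.intervalIntegral_comp_comm S
      ((hi hw.integrable ht).sub (hi hw'.integrable ht)), hz t ht]
  refine ⟨fun t ht => sub_eq_zero.1 (by rw [← map_sub]; exact h0 t ht), ?_⟩
  refine (ae_eq_zero_of_forall_integral_eq_zero (hw.integrable.sub hw'.integrable)
    fun t ht => ?_).mono fun t ht => sub_eq_zero.1 ht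
  rw [← h0 t ht, hz t ht]
  rfl

theorem Generates.weak_unique (hT : Generates (graphAR k μ S) T) (htf : 0 < tf)
    (hw : IsWeakSolution (S : X →ₗ[ℂ] X) (idOp X) (fun _ => 0) w₀ tf w)
    (hw' : IsWeakSolution (S : X →ₗ[ℂ] X) (idOp X) (fun _ => 0) w₀ tf w') :
    (∀ t ∈ Icc 0 tf, S (w t) = S (w' t)) ∧
      ∀ x' : StrongDual ℂ X, ∀ᵐ t ∂(volume.restrict (Icc 0 tf)), x' (w t) = x' (w' t) := by
  have hd (x' : StrongDual ℂ X) :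
      HasWeakDerivOn (fun t => x' (S (w t - w' t))) (fun t => x' (w t - w' t)) 0 tf := by
    simpa using (hw.hasWeakDerivOn x').sub (hw'.hasWeakDerivOn x')
  have hc : ContinuousOn (fun t => S (w t - w' t)) (Icc 0 tf) := by
    simpa using hw.continuousOn.fun_sub hw'.continuousOn
  have hi0 : S (w 0 - w' 0) = 0 := by
    rw [map_sub, sub_eq_zero]
    exact hw.initial.trans hw'.initial.symm
  -- Testing with `x' ∘ S` makes the weak derivative continuous.
  have h0 := hT.eq_zero_of_map_eq_integral htf hc fun t ht => by
    refine (SeparatingDual.eq_iff_forall_dual_eq (R := ℂ)).2 fun x' => ?_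
    rw [← ContinuousLinearMap.intervalIntegral_comp_comm x'
      (intervalIntegrable_of_continuousOn_Icc hc ht)]
    have := (hd (x'.comp S)).sub_eq_integral htf
      ((x'.comp S).continuous.comp_continuousOn hc) (x'.continuous.comp_continuousOn hc) t ht
    simpa [hi0] using this
  refine ⟨fun t ht => sub_eq_zero.1 (by rw [← map_sub]; exact h0 t ht), fun x' => ?_⟩
  refine ((hd x').ae_eq_zero fun t ht => by rw [h0 t ht, map_zero]).mono fun t ht => ?_
  rwa [map_sub, sub_eq_zero] at ht

theorem Generates.classical_unique (hT : Generates (graphAR k μ S) T) (htf : 0 < tf)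
    (hw : IsClassicalSolution (S : X →ₗ[ℂ] X) (idOp X) (fun _ => 0) w₀ tf w)
    (hw' : IsClassicalSolution (S : X →ₗ[ℂ] X) (idOp X) (fun _ => 0) w₀ tf w') :
    (∀ t ∈ Icc 0 tf, S (w t) = S (w' t)) ∧ ∀ t ∈ Ioo 0 tf, w t = w' t := by
  have hd {v : ℝ → X} (hv : IsClassicalSolution (S : X →ₗ[ℂ] X) (idOp X) (fun _ => 0) w₀ tf v)
      {t : ℝ} (ht : t ∈ Ioo 0 tf) : HasDerivAt (fun s => S (v s)) (v t) t := by
    obtain ⟨h, h'⟩ := hv.equation t ht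
    simpa [idOp] using h'
  have hc : ContinuousOn (fun t => S (w t - w' t)) (Icc 0 tf) := by
    simpa using hw.continuousOn.fun_sub hw'.continuousOn
  have hi0 : S (w 0 - w' 0) = 0 := by
    rw [map_sub, sub_eq_zero]
    exact hw.initial.trans hw'.initial.symm
  have hdz {t : ℝ} (ht : t ∈ Ioo 0 tf) :
      HasDerivAt (fun s => S (w s - w' s)) (w t - w' t) t := by
    simpa using (hd hw ht).fun_sub (hd hw' ht)
  have h0 := hT.eq_zero_of_map_eq_integral htf hc fun t ht => by
    rw [intervalIntegral.integral_eq_sub_of_hasDerivAt_of_le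
      (f := fun s => S (S (w s - w' s))) (f' := fun s => S (w s - w' s)) ht.1
      (S.continuous.comp_continuousOn (hc.mono (Icc_subset_Icc_right ht.2)))
      (fun s hs => (S.restrictScalars ℝ).hasFDerivAt.comp_hasDerivAt s
        (hdz ⟨hs.1, hs.2.trans_le ht.2⟩))
      (intervalIntegrable_of_continuousOn_Icc hc ht)]
    simp only [hi0, map_zero, sub_zero]
  refine ⟨fun t ht => sub_eq_zero.1 (by rw [← map_sub]; exact h0 t ht), fun t ht => ?_⟩
  refine sub_eq_zero.1 ((hdz ht).unique ((hasDerivAt_const t (0 : X)).congr_of_eventuallyEq ?_))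
  filter_upwards [Icc_mem_nhds ht.1 ht.2] with s hs using h0 s hs

end Uniqueness

end ADAE

theorem mainTheorem7 {X : Type*} [NormedAddCommGroup X] [NormedSpace ℂ X] [CompleteSpace X]
    (Ω : Set ℂ) (R : ℂ → X →L[ℂ] X) (hR : ADAE.IsPseudoResolvent Ω R)
    (k : ℕ) (hk : 1 ≤ k) (hD : ADAE.CondD k Ω R)
    (μ : ℂ) (hμ : μ ∈ Ω)
    (T : ℝ → ADAE.closedRange k (R μ) →L[ℂ] ADAE.closedRange k (R μ))
    (hT : ADAE.Generates (ADAE.graphAR k μ (R μ)) T)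
    (tf : ℝ) (htf : 0 < tf)
    (w₀ : ADAE.closedRange k (R μ)) (wμ : ℝ → X)
    (hwμ : ∀ t ∈ Icc (0 : ℝ) tf, wμ t = Complex.exp (-μ * t) • (T t w₀ : X)) :
    -- `wμ` is the unique mild solution
    (ADAE.IsMildSolution (R μ : X →ₗ[ℂ] X) (ADAE.idOp X) (fun _ => 0) (w₀ : X) tf wμ ∧
      ∀ w : ℝ → X,
        ADAE.IsMildSolution (R μ : X →ₗ[ℂ] X) (ADAE.idOp X) (fun _ => 0) (w₀ : X) tf w →
        (∀ t ∈ Icc 0 tf, R μ (w t) = R μ (wμ t)) ∧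
        ∀ᵐ t ∂(volume.restrict (Icc 0 tf)), w t = wμ t) ∧
    -- `wμ` is the unique weak solution
    (ADAE.IsWeakSolution (R μ : X →ₗ[ℂ] X) (ADAE.idOp X) (fun _ => 0) (w₀ : X) tf wμ ∧
      ∀ w : ℝ → X,
        ADAE.IsWeakSolution (R μ : X →ₗ[ℂ] X) (ADAE.idOp X) (fun _ => 0) (w₀ : X) tf w →
        (∀ t ∈ Icc 0 tf, R μ (w t) = R μ (wμ t)) ∧
        (∀ x' : StrongDual ℂ X, ∀ᵐ t ∂(volume.restrict (Icc 0 tf)), x' (w t) = x' (wμ t)) ∧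
        ((∃ s : Set X, TopologicalSpace.IsSeparable s ∧
            ∀ᵐ t ∂(volume.restrict (Icc 0 tf)), w t ∈ s) →
          ∀ᵐ t ∂(volume.restrict (Icc 0 tf)), w t = wμ t)) ∧
    -- for `w₀ ∈ R(μ) V`, `wμ` is the unique classical solution
    ((∃ v : ADAE.closedRange k (R μ), (w₀ : X) = R μ v) →
      ADAE.IsClassicalSolution (R μ : X →ₗ[ℂ] X) (ADAE.idOp X) (fun _ => 0) (w₀ : X) tf wμ ∧
      ∀ w : ℝ → X,
        ADAE.IsClassicalSolution (R μ : X →ₗ[ℂ] X) (ADAE.idOp X) (fun _ => 0) (w₀ : X) tf w →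
        (∀ t ∈ Icc 0 tf, R μ (w t) = R μ (wμ t)) ∧
        ∀ t ∈ Ioo 0 tf, w t = wμ t) := by
  have hcont : ContinuousOn wμ (Icc 0 tf) :=
    ((hT.continuousOn_orbit w₀).mono Icc_subset_Ici_self).congr hwμ
  have heq : ∀ t ∈ Icc 0 tf, R μ (wμ t) - R μ w₀ = ∫ τ in (0 : ℝ)..t, wμ τ := fun t ht => by
    rw [hwμ t ht, hT.map_orbit_sub_eq_integral w₀ ht.1]
    refine intervalIntegral.integral_congr fun τ hτ => ?_
    rw [uIcc_of_le ht.1] at hτ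
    exact (hwμ τ ⟨hτ.1, hτ.2.trans ht.2⟩).symm
  have hmild := ADAE.isMildSolution_of_map_sub_eq_integral hcont heq
  have hweak := ADAE.isWeakSolution_of_map_sub_eq_integral htf.le hcont heq
  have hclass := ADAE.isClassicalSolution_of_map_sub_eq_integral htf.le hcont heq
  refine ⟨⟨hmild, fun w hw => hT.mild_unique htf hw hmild⟩, ⟨hweak, fun w hw => ?_⟩,
    fun _ => ⟨hclass, fun w hw => hT.classical_unique htf hw hclass⟩⟩
  obtain ⟨h₁, h₂⟩ := hT.weak_unique htf hw hweak
  refine ⟨h₁, h₂, ?_⟩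
  rintro ⟨s, hs, hws⟩
  have hsep : TopologicalSpace.IsSeparable
      ((fun p : X × X => p.1 - p.2) '' s ×ˢ (wμ '' Icc 0 tf)) :=
    (hs.prod (isCompact_Icc.image_of_continuousOn hcont).isSeparable).image continuous_sub
  refine (ae_eq_zero_of_forall_dual_of_isSeparable ℂ hsep (f := fun t => w t - wμ t)
    (fun x' => ?_) ?_).mono fun t ht => sub_eq_zero.1 ht
  · filter_upwards [h₂ x'] with t ht
    simp [ht]
  · filter_upwards [hws, ae_restrict_mem measurableSet_Icc] with t ht htI
    exact ⟨(w t, wμ t), ⟨ht, mem_image_of_mem _ htI⟩, rfl⟩
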